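/- For a real number $\delta$ with $0<\delta<1$ and a measurable function $f:(0,\infty)\to\mathbb{C}$, consider the Salem integral equation $$\int_{0}^{\infty}\frac{t^{\delta-1}}{e^{xt}+1}\,f(t)\,dt=0\qquad\text{for all } x>0. \tag{$S_\delta$}$$ The following two conditions are equivalent: (a) for each $0<\delta<1$ with $\delta\neq\frac12$, the only bounded measurable function $f:(0,\infty)\to\mathbb{C}$ satisfying $(S_\delta)$ is $f=0$ almost everywhere; (b) for each $0<\delta<1$ with $\delta\neq\frac12$, the equation $(S_\delta)$ has no solution of the form $f(t)=t^{i\gamma}$, $t\in(0,\infty)$, with $\gamma\in\mathbb{R}$. -/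

import Mathlib

open MeasureTheory Set

/-- `f` solves the Salem integral equation with parameter `δ`:
`∫₀^∞ t^(δ-1) / (e^(xt) + 1) · f(t) dt = 0` for all `x > 0`. Only the values of `f` on `(0, ∞)`
matter. If `0 < δ` and `f` is bounded and measurable on `(0, ∞)`, the integrals converge
absolutely. -/
def SolvesSalemEquation (δ : ℝ) (f : ℝ → ℂ) : Prop :=
  ∀ x : ℝ, 0 < x →
    ∫ t in Ioi (0 : ℝ), ((t ^ (δ - 1) / (Real.exp (x * t) + 1) : ℝ) : ℂ) * f t = 0

/-- `f` is a bounded (Lebesgue) measurable function on `(0, ∞)`. -/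
def IsBoundedMeasurableOnPos (f : ℝ → ℂ) : Prop :=
  AEMeasurable f (volume.restrict (Ioi (0 : ℝ))) ∧ ∃ C : ℝ, ∀ t : ℝ, 0 < t → ‖f t‖ ≤ C

open scoped FourierTransform ContDiff

/-! With `t = e^v` and `x = e^{-y}` the equation says that `F(v) = f(e^v)` is annihilated by all
translates of `salemKernel δ`. Testing `F(v) = e^{iγv}` gives a phase times the kernel's Fourier
transform at `-γ/(2π)`, so (b) says that this transform has no zeros, and Wiener's Tauberian theorem
then forces `F = 0`. Since the kernel decays exponentially, its transform is smooth, so division by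
it preserves test functions and Wiener's lemma on inverses is not needed. Conversely, `t^{iγ}` is
bounded and nonzero. -/

/-- The Fourier transform is injective on `L¹(ℝ)`. -/
theorem ae_eq_zero_of_fourier_eq_zero {f : ℝ → ℂ} (hf : Integrable f)
    (h : ∀ ξ, 𝓕 f ξ = 0) : ∀ᵐ v, f v = 0 := by
  refine ae_eq_zero_of_integral_contDiff_smul_eq_zero hf.locallyIntegrable fun g hg hgc ↦ ?_
  have hgc' : HasCompactSupport (fun x ↦ (g x : ℂ)) := hgc.comp_left (g := Complex.ofReal) rfl
  have hg' : ContDiff ℝ ∞ (fun x ↦ (g x : ℂ)) := Complex.ofRealCLM.contDiff.comp hg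
  set ψ : SchwartzMap ℝ ℂ := hgc'.toSchwartzMap hg'
  set θ : SchwartzMap ℝ ℂ := 𝓕⁻ ψ with hθ
  have key : ∫ ξ, 𝓕 f ξ • θ ξ = ∫ x, f x • 𝓕 (⇑θ) x := by
    have := VectorFourier.integral_fourierIntegral_smul_eq_flip (μ := volume) (ν := volume)
      (L := innerₗ ℝ) Real.continuous_fourierChar continuous_inner hf θ.integrable
    rwa [flip_innerₗ] at this
  rw [← SchwartzMap.fourier_coe, hθ, FourierTransform.fourier_fourierInv_eq] at key
  simp only [h, zero_smul, integral_zero] at key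
  rw [key]
  refine integral_congr_ae (.of_forall fun x ↦ ?_)
  simp [ψ, mul_comm]

/-- A convolution with the inverse Fourier transform of a Schwartz function is computed on the
Fourier side. -/
theorem integral_mul_fourierInv_eq {h : ℝ → ℂ} (hh : Integrable h) (G : SchwartzMap ℝ ℂ) (v : ℝ) :
    ∫ w, h (v - w) * (𝓕⁻ G) w = 𝓕⁻ (fun ξ ↦ 𝓕 h ξ * G ξ) v := by
  set g : ℝ → ℂ := fun ξ ↦ Real.fourierChar (ξ * v) • G ξ
  have hg : Integrable g := by
    have := (Real.fourierIntegral_convergent_iff (μ := volume) (-v)).2 G.integrable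
    simpa [g, mul_comm] using this
  have key : ∫ ξ, 𝓕 h ξ • g ξ = ∫ x, h x • 𝓕 g x := by
    have := VectorFourier.integral_fourierIntegral_smul_eq_flip (μ := volume) (ν := volume)
      (L := innerₗ ℝ) Real.continuous_fourierChar continuous_inner hh hg
    rwa [flip_innerₗ] at this
  have h1 : ∀ x, 𝓕 g x = (𝓕⁻ G) (v - x) := by
    intro x
    rw [SchwartzMap.fourierInv_coe, Real.fourier_eq, Real.fourierInv_eq]
    refine integral_congr_ae (.of_forall fun ξ ↦ ?_)
    simp only [g, Circle.smul_def, smul_eq_mul, ← mul_assoc, ← Circle.coe_mul,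
      ← AddChar.map_add_eq_mul]
    congr 3
    simp
    ring
  rw [Real.fourierInv_eq, ← integral_sub_left_eq_self _ volume v]
  simp only [sub_sub_cancel, smul_eq_mul, h1] at key ⊢
  rw [← key]
  refine integral_congr_ae (.of_forall fun ξ ↦ ?_)
  simp only [g, Circle.smul_def, smul_eq_mul]
  simp [mul_comm v ξ]
  ring

/-! ### Wiener's theorem for a smooth nonvanishing transform. -/

section Tauberian

variable {h F : ℝ → ℂ} {C : ℝ}

/-- By Fubini, the pairing is a superposition of the vanishing pairings `hconv`. -/
theorem integral_mul_fourierInv_fourier_mul_eq_zero (hh : Integrable h)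
    (hF : AEStronglyMeasurable F) (hFC : ∀ v, ‖F v‖ ≤ C)
    (hconv : ∀ y, ∫ v, h (v - y) * F v = 0) (G : SchwartzMap ℝ ℂ) :
    ∫ v, F v * 𝓕⁻ (fun ξ ↦ 𝓕 h ξ * G ξ) v = 0 := by
  have hint : Integrable (fun p : ℝ × ℝ ↦ F p.1 * (h (p.1 - p.2) * (𝓕⁻ G) p.2))
      (volume.prod volume) := by
    have h0 := (𝓕⁻ G).integrable (μ := volume)
    have h1 := h0.convolution_integrand (ContinuousLinearMap.mul ℂ ℂ) hh
    refine Integrable.bdd_mul (c := C) ?_ hF.comp_fst (.of_forall fun p ↦ hFC _)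
    simpa [mul_comm] using h1
  simp only [← integral_mul_fourierInv_eq hh, ← integral_const_mul]
  rw [integral_integral_swap hint]
  have : ∀ w, ∫ v, F v * (h (v - w) * (𝓕⁻ G) w) = 0 := fun w ↦ by
    have hv : ∀ v, F v * (h (v - w) * (𝓕⁻ G) w) = h (v - w) * F v * (𝓕⁻ G) w := fun v ↦ by ring
    simp only [hv]
    rw [integral_mul_const, hconv, zero_mul]
  simp [this]

/-- If the Fourier transform of `h` is smooth and has no zeros, a bounded function annihilated by
all translates of `h` annihilates every function with smooth compactly supported spectrum. -/
theorem integral_mul_fourierInv_eq_zero (hh : Integrable h) (hsmooth : ContDiff ℝ ∞ (𝓕 h))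
    (hne : ∀ ξ, 𝓕 h ξ ≠ 0) (hF : AEStronglyMeasurable F) (hFC : ∀ v, ‖F v‖ ≤ C)
    (hconv : ∀ y, ∫ v, h (v - y) * F v = 0) {χ : ℝ → ℂ} (hχ : ContDiff ℝ ∞ χ)
    (hχc : HasCompactSupport χ) :
    ∫ v, F v * 𝓕⁻ χ v = 0 := by
  have hG : HasCompactSupport (fun ξ ↦ (𝓕 h ξ)⁻¹ * χ ξ) := hχc.mul_left
  have := integral_mul_fourierInv_fourier_mul_eq_zero hh hF hFC hconv
    (hG.toSchwartzMap ((hsmooth.inv hne).mul hχ))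
  simpa [hne] using this

/-- Modulating `𝓕⁻ χ` translates `χ`, which stays a test function; hence `F * 𝓕⁻ χ` has zero Fourier
transform. -/
theorem ae_mul_fourierInv_eq_zero (hh : Integrable h) (hsmooth : ContDiff ℝ ∞ (𝓕 h))
    (hne : ∀ ξ, 𝓕 h ξ ≠ 0) (hF : AEStronglyMeasurable F) (hFC : ∀ v, ‖F v‖ ≤ C)
    (hconv : ∀ y, ∫ v, h (v - y) * F v = 0) {χ : ℝ → ℂ} (hχ : ContDiff ℝ ∞ χ)
    (hχc : HasCompactSupport χ) :
    ∀ᵐ v, F v * 𝓕⁻ χ v = 0 := by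
  have hk : Integrable (𝓕⁻ χ) := by
    have := (𝓕⁻ (hχc.toSchwartzMap hχ)).integrable (μ := volume)
    rwa [SchwartzMap.fourierInv_coe] at this
  refine ae_eq_zero_of_fourier_eq_zero (hk.bdd_mul hF (.of_forall hFC)) fun a ↦ ?_
  have h1 := integral_mul_fourierInv_eq_zero hh hsmooth hne hF hFC hconv
    (χ := fun ξ ↦ χ (ξ + a)) (hχ.comp (contDiff_id.add contDiff_const))
    (hχc.comp_homeomorph (Homeomorph.addRight a))
  rw [← h1, Real.fourier_eq]
  refine integral_congr_ae (.of_forall fun v ↦ ?_)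
  simp only [Real.fourierInv_eq, Circle.smul_def, smul_eq_mul]
  rw [mul_left_comm, ← integral_const_mul,
    ← integral_add_right_eq_self (fun ξ ↦ _ * ((Real.fourierChar (inner ℝ ξ v) : ℂ) * χ ξ)) a]
  congr 1
  refine integral_congr_ae (.of_forall fun ξ ↦ ?_)
  simp only [← mul_assoc, ← Circle.coe_mul, ← AddChar.map_add_eq_mul]
  congr 3
  simp
  ring

/-- **Wiener's Tauberian theorem** for kernels with smooth Fourier transform: if the Fourier
transform of `h` has no zeros, then only the zero function in `L^∞` is annihilated by all translates
of `h`. -/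
theorem ae_eq_zero_of_forall_integral_translate_mul_eq_zero (hh : Integrable h)
    (hsmooth : ContDiff ℝ ∞ (𝓕 h)) (hne : ∀ ξ, 𝓕 h ξ ≠ 0) (hF : Measurable F)
    (hFC : ∀ v, ‖F v‖ ≤ C) (hconv : ∀ y, ∫ v, h (v - y) * F v = 0) :
    ∀ᵐ v, F v = 0 := by
  let b : ContDiffBump (0 : ℝ) := ⟨1, 2, one_pos, one_lt_two⟩
  have hbc : HasCompactSupport (fun x ↦ (b x : ℂ)) :=
    b.hasCompactSupport.comp_left (g := Complex.ofReal) rfl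
  have hb : ContDiff ℝ ∞ (fun x ↦ (b x : ℂ)) := Complex.ofRealCLM.contDiff.comp b.contDiff
  set k : ℝ → ℂ := 𝓕⁻ (fun x ↦ (b x : ℂ)) with hkdef
  have hkcont : Continuous k := by
    have := (𝓕⁻ (hbc.toSchwartzMap hb)).continuous
    rwa [SchwartzMap.fourierInv_coe] at this
  have hk0 : k 0 ≠ 0 := by
    have : k 0 = ((∫ x, b x : ℝ) : ℂ) := by
      rw [hkdef, Real.fourierInv_eq]
      simp [integral_complex_ofReal]
    rw [this]
    exact_mod_cast b.integral_pos.ne'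
  obtain ⟨ε, hε, hkε⟩ := Metric.eventually_nhds_iff.1 (hkcont.continuousAt.eventually_ne hk0)
  -- `k` is nonzero only near `0`, as far as is known; countably many translates cover the line and
  -- keep the exceptional set null.
  have hae : ∀ᵐ v, ∀ q : ℚ, F v * k (v - q) = 0 := by
    refine ae_all_iff.2 fun q ↦ ?_
    have h1 : ∀ᵐ v, F (v + q) * k v = 0 := by
      refine ae_mul_fourierInv_eq_zero (F := fun v ↦ F (v + q)) hh hsmooth hne
        (hF.comp (measurable_add_const _)).aestronglyMeasurable (fun v ↦ hFC _) (fun y ↦ ?_) hb hbc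
      rw [← hconv (y + q), ← integral_add_right_eq_self (fun v ↦ h (v - (y + q)) * F v) (q : ℝ)]
      simp
    have h2 := (measurePreserving_sub_right volume (q : ℝ)).quasiMeasurePreserving.ae h1
    simpa using h2
  filter_upwards [hae] with v hv
  obtain ⟨q, hq1, hq2⟩ := exists_rat_btwn (show v - ε < v by linarith)
  refine (mul_eq_zero.1 (hv q)).resolve_right (hkε ?_)
  rw [dist_zero_right, Real.norm_eq_abs, abs_lt]
  constructor <;> linarith

end Tauberian

/-! ### The kernel and its decay. -/

/-- The kernel of the Salem equation in logarithmic coordinates. -/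
noncomputable def salemKernel (δ u : ℝ) : ℝ := Real.exp (δ * u) / (Real.exp (Real.exp u) + 1)

theorem continuous_salemKernel (δ : ℝ) : Continuous (salemKernel δ) := by
  unfold salemKernel
  exact Continuous.div (by fun_prop) (by fun_prop) fun u ↦ by positivity

theorem salemKernel_nonneg (δ u : ℝ) : 0 ≤ salemKernel δ u := by
  unfold salemKernel; positivity

theorem salemKernel_le {δ : ℝ} (hδ1 : δ < 1) (u : ℝ) :
    salemKernel δ u ≤ 2 * Real.exp (-δ * |u|) := by
  unfold salemKernel
  rw [div_le_iff₀ (by positivity)]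
  rcases le_total 0 u with hu | hu
  · rw [abs_of_nonneg hu]
    have h1 : Real.exp u ^ 2 / 2 ≤ Real.exp (Real.exp u) := by
      have := Real.quadratic_le_exp_of_nonneg (Real.exp_pos u).le
      have := Real.exp_pos u
      linarith
    -- This is `2δu ≤ 2u`, the use of `δ < 1`.
    have h2 : Real.exp (δ * u) ≤ Real.exp (-δ * u) * Real.exp u ^ 2 := by
      rw [← Real.exp_nat_mul, ← Real.exp_add]
      refine Real.exp_le_exp.2 ?_
      push_cast
      nlinarith
    have := mul_le_mul_of_nonneg_left h1 (Real.exp_pos (-δ * u)).le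
    nlinarith [Real.exp_pos (-δ * u)]
  · rw [abs_of_nonpos hu, neg_mul_neg]
    nlinarith [Real.exp_pos (δ * u), Real.exp_pos (Real.exp u)]

theorem integrable_comp_abs {f : ℝ → ℝ} (hf : IntegrableOn f (Ioi 0)) :
    Integrable fun u ↦ f |u| := by
  have h := hf.integrable_indicator measurableSet_Ioi
  refine (h.add h.comp_neg).congr ?_
  filter_upwards [Measure.ae_ne volume (0 : ℝ)] with u hu
  rcases hu.lt_or_gt with hu | hu
  · simp [indicator, hu, hu.le, abs_of_neg]
  · simp [indicator, hu, hu.le, abs_of_pos]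

theorem integrable_pow_mul_salemKernel {δ : ℝ} (hδ0 : 0 < δ) (hδ1 : δ < 1) (n : ℕ) :
    Integrable fun u : ℝ ↦ ‖u‖ ^ n * ‖(salemKernel δ u : ℂ)‖ := by
  have h1 : IntegrableOn (fun u : ℝ ↦ u ^ (n : ℝ) * Real.exp (-δ * u)) (Ioi 0) := by
    simpa using integrableOn_rpow_mul_exp_neg_mul_rpow (p := 1) (s := n) (b := δ)
      (by have := n.cast_nonneg (α := ℝ); linarith) one_pos hδ0
  have h2 : Integrable fun u : ℝ ↦ |u| ^ (n : ℝ) * Real.exp (-δ * |u|) :=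
    integrable_comp_abs (f := fun u ↦ u ^ (n : ℝ) * Real.exp (-δ * u)) h1
  refine (h2.const_mul 2).mono' ?_ (.of_forall fun u ↦ ?_)
  · have := continuous_salemKernel δ
    exact Continuous.aestronglyMeasurable (by fun_prop)
  · rw [Real.norm_of_nonneg (by positivity), Real.rpow_natCast, Complex.norm_real,
      Real.norm_of_nonneg (salemKernel_nonneg δ u), Real.norm_eq_abs]
    have := mul_le_mul_of_nonneg_left (salemKernel_le hδ1 u) (pow_nonneg (abs_nonneg u) n)
    linarith

theorem integrable_salemKernel {δ : ℝ} (hδ0 : 0 < δ) (hδ1 : δ < 1) :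
    Integrable fun u : ℝ ↦ (salemKernel δ u : ℂ) := by
  have := integrable_pow_mul_salemKernel hδ0 hδ1 0
  have hc : AEStronglyMeasurable (fun u : ℝ ↦ (salemKernel δ u : ℂ)) :=
    (Complex.continuous_ofReal.comp (continuous_salemKernel δ)).aestronglyMeasurable
  exact (integrable_norm_iff hc).1 (by simpa using this)

/-! ### Logarithmic change of variables. -/

theorem image_exp_univ : Real.exp '' univ = Ioi 0 := by
  rw [image_univ, Real.range_exp]

/-- The Salem equation at `x = e^{-y}` in logarithmic coordinates. -/
theorem setIntegral_salem_eq (δ y : ℝ) (f : ℝ → ℂ) :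
    ∫ t in Ioi (0 : ℝ), ((t ^ (δ - 1) / (Real.exp (Real.exp (-y) * t) + 1) : ℝ) : ℂ) * f t =
      Real.exp (δ * y) * ∫ v, (salemKernel δ (v - y) : ℂ) * f (Real.exp v) := by
  rw [← image_exp_univ, integral_image_eq_integral_abs_deriv_smul MeasurableSet.univ
    (fun x _ ↦ (Real.hasDerivAt_exp x).hasDerivWithinAt) Real.exp_injective.injOn,
    Measure.restrict_univ, ← integral_const_mul]
  refine integral_congr_ae (.of_forall fun v ↦ ?_)
  simp only [Complex.real_smul, ← mul_assoc, ← Complex.ofReal_mul]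
  congr 2
  rw [abs_of_pos (Real.exp_pos v), salemKernel, ← Real.exp_add, ← Real.exp_mul, ← mul_div_assoc,
    ← mul_div_assoc, ← Real.exp_add, ← Real.exp_add]
  ring_nf

theorem solvesSalemEquation_iff (δ : ℝ) (f : ℝ → ℂ) :
    SolvesSalemEquation δ f ↔ ∀ y, ∫ v, (salemKernel δ (v - y) : ℂ) * f (Real.exp v) = 0 := by
  constructor
  · intro h y
    have := h _ (Real.exp_pos (-y))
    rw [setIntegral_salem_eq] at this
    exact (mul_eq_zero.1 this).resolve_left (by exact_mod_cast (Real.exp_pos _).ne')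
  · intro h x hx
    have := setIntegral_salem_eq δ (-Real.log x) f
    rwa [h, mul_zero, neg_neg, Real.exp_log hx] at this

theorem solvesSalemEquation_cpow_of_fourier_eq_zero {δ ξ : ℝ}
    (h : 𝓕 (fun u : ℝ ↦ (salemKernel δ u : ℂ)) ξ = 0) :
    SolvesSalemEquation δ
      (fun t : ℝ => (t : ℂ) ^ (Complex.I * ((-(2 * Real.pi * ξ) : ℝ) : ℂ))) := by
  rw [solvesSalemEquation_iff]
  intro y
  rw [← integral_add_right_eq_self _ y]
  rw [Real.fourier_real_eq_integral_exp_smul] at h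
  rw [← mul_zero (Complex.exp (((-2 * Real.pi * y * ξ : ℝ) : ℂ) * Complex.I)), ← h,
    ← integral_const_mul]
  refine integral_congr_ae (.of_forall fun v ↦ ?_)
  simp only [add_sub_cancel_right, smul_eq_mul, ← mul_assoc, ← Complex.exp_add]
  rw [Complex.cpow_def_of_ne_zero (by exact_mod_cast (Real.exp_pos _).ne'), ← Complex.ofReal_log
    (Real.exp_pos _).le, Real.log_exp, mul_comm]
  congr 2
  push_cast
  ring

theorem ae_restrict_Ioi_eq_zero_of_comp_exp {f : ℝ → ℂ} (h : ∀ᵐ v, f (Real.exp v) = 0) :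
    ∀ᵐ t ∂(volume.restrict (Ioi (0 : ℝ))), f t = 0 := by
  rw [ae_restrict_iff' measurableSet_Ioi, ae_iff]
  refine measure_mono_null (t := Real.exp '' {v | ¬ f (Real.exp v) = 0}) ?_
    (addHaar_image_eq_zero_of_differentiableOn_of_addHaar_eq_zero volume
      Real.differentiable_exp.differentiableOn (ae_iff.1 h))
  intro t ht
  simp only [mem_ofPred_eq, Classical.not_imp, mem_Ioi] at ht
  exact ⟨Real.log t, by simpa [Real.exp_log ht.1] using ht.2, Real.exp_log ht.1⟩

theorem IsBoundedMeasurableOnPos.exists_measurable_ae_eq {f : ℝ → ℂ}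
    (hf : IsBoundedMeasurableOnPos f) :
    ∃ g : ℝ → ℂ, Measurable g ∧ (∃ C, ∀ t, ‖g t‖ ≤ C) ∧
      f =ᵐ[volume.restrict (Ioi (0 : ℝ))] g := by
  obtain ⟨hm, C, hC⟩ := hf
  set f₀ := hm.mk f
  -- `f₀` inherits the bound only almost everywhere, so its large values are cut off.
  refine ⟨{t | ‖f₀ t‖ ≤ C}.indicator f₀,
    hm.measurable_mk.indicator (measurableSet_le hm.measurable_mk.norm measurable_const),
    ⟨max C 0, fun t ↦ ?_⟩, ?_⟩
  · by_cases ht : ‖f₀ t‖ ≤ C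
    · rw [indicator_of_mem (s := {t | ‖f₀ t‖ ≤ C}) ht]
      exact le_max_of_le_left ht
    · rw [indicator_of_notMem (s := {t | ‖f₀ t‖ ≤ C}) ht]
      simp
  · filter_upwards [hm.ae_eq_mk, ae_restrict_mem measurableSet_Ioi] with t ht ht0
    have : ‖f₀ t‖ ≤ C := by
      have := hC t ht0
      rwa [ht] at this
    rw [indicator_of_mem (show t ∈ {t | ‖f₀ t‖ ≤ C} from this), ht]

theorem SolvesSalemEquation.congr_ae {δ : ℝ} {f g : ℝ → ℂ} (hf : SolvesSalemEquation δ f)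
    (hfg : f =ᵐ[volume.restrict (Ioi (0 : ℝ))] g) : SolvesSalemEquation δ g := fun x hx ↦ by
  rw [← hf x hx]
  refine integral_congr_ae ?_
  filter_upwards [hfg] with t ht
  rw [ht]

theorem norm_cpow_I_mul {t : ℝ} (ht : 0 < t) (γ : ℝ) :
    ‖(t : ℂ) ^ (Complex.I * (γ : ℂ))‖ = 1 := by
  rw [Complex.norm_cpow_eq_rpow_re_of_pos ht]
  simp

theorem isBoundedMeasurableOnPos_cpow (γ : ℝ) :
    IsBoundedMeasurableOnPos fun t : ℝ => (t : ℂ) ^ (Complex.I * (γ : ℂ)) :=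
  ⟨(Complex.measurable_ofReal.pow_const _).aemeasurable, 1, fun _ ht ↦ (norm_cpow_I_mul ht γ).le⟩

theorem mainTheorem2 :
    (∀ δ : ℝ, 0 < δ → δ < 1 → δ ≠ 1 / 2 →
      ∀ f : ℝ → ℂ, IsBoundedMeasurableOnPos f → SolvesSalemEquation δ f →
        ∀ᵐ t ∂(volume.restrict (Ioi (0 : ℝ))), f t = 0) ↔
    (∀ δ : ℝ, 0 < δ → δ < 1 → δ ≠ 1 / 2 →
      ¬ ∃ γ : ℝ, SolvesSalemEquation δ (fun t : ℝ => (t : ℂ) ^ (Complex.I * (γ : ℂ)))) := by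
  constructor
  · rintro h δ hδ0 hδ1 hδ ⟨γ, hγ⟩
    have h0 := h δ hδ0 hδ1 hδ _ (isBoundedMeasurableOnPos_cpow γ) hγ
    have : ∀ᵐ t ∂(volume.restrict (Ioi (0 : ℝ))), False := by
      filter_upwards [h0, ae_restrict_mem measurableSet_Ioi] with t ht ht0
      simpa [ht] using norm_cpow_I_mul ht0 γ
    rw [Filter.eventually_false_iff_eq_bot, ae_eq_bot] at this
    simpa using congrArg (· univ) this
  · intro h δ hδ0 hδ1 hδ f hf hsolves
    obtain ⟨g, hg, ⟨C, hC⟩, hfg⟩ := hf.exists_measurable_ae_eq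
    have hg0 : ∀ᵐ v, g (Real.exp v) = 0 :=
      ae_eq_zero_of_forall_integral_translate_mul_eq_zero (integrable_salemKernel hδ0 hδ1)
        (Real.contDiff_fourier fun n _ ↦ integrable_pow_mul_salemKernel hδ0 hδ1 n)
        (fun ξ hξ ↦ h δ hδ0 hδ1 hδ ⟨_, solvesSalemEquation_cpow_of_fourier_eq_zero hξ⟩)
        (hg.comp Real.measurable_exp) (fun v ↦ hC _)
        ((solvesSalemEquation_iff δ g).1 (hsolves.congr_ae hfg))
    filter_upwards [hfg, ae_restrict_Ioi_eq_zero_of_comp_exp hg0] with t h1 h2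
    rw [h1, h2]
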